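/- **Theorem.** For a $T_0$-space $X$ the following conditions are equivalent: 1. $X$ is metrizable; 2. $X$ is a first-countable closed-$\bar G_\delta$ space with a countable locally uniform $\mathsf{cs}^*$-netbase; 3. $X$ is a first-countable strong $\sigma$-space with a countable locally quasi-uniform $\mathsf{cs}^*$-netbase; 4. $X$ is a first-countable collectionwise normal $\Sigma$-space with a countable locally uniform $\mathsf{cs}^*$-netbase; 5. $X$ is an $M$-space with a countable locally uniform $\mathsf{ccs}^{**}$-netbase; 6. $X$ is a $q$-space and a collectionwise normal $\Sigma$-space, and has a countable locally uniform $\mathsf{ccs}^{**}$-netbase. Here the following definitions are used. *Netbases.* An entourage on $X$ is a set $U\subset X\times X$ containing the diagonal; $U[x]=\{y:(x,y)\in U\}$, $U^{-1}=\{(y,x):(x,y)\in U\}$ and $UV=\{(x,z):\exists y\;(x,y)\in U,\ (y,z)\in V\}$. An entourage base for the topological space $X$ is a family $\mathcal B$ of entourages such that any $U,V\in\mathcal B$ admit $W\in\mathcal B$ with $W\subset U\cap V$, and for every $x\in X$ the family $\{B[x]:B\in\mathcal B\}$ is a neighborhood base at $x$. It is locally uniform (resp. locally quasi-uniform) if for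 every $x\in X$ and every neighborhood $O_x$ of $x$ there is $U\in\mathcal B$ with $UU^{-1}U[x]\subset O_x$ (resp. $UU[x]\subset O_x$). A set $A\subset X$ accumulates at $x$ if every neighborhood of $x$ contains infinitely many points of $A$. Let $\mathcal C$ be a family of subsets of $X$, $\mathcal E$ a family of entourages on $X$ and $\mathcal B$ an entourage base for $X$. The pair $(\mathcal E,\mathcal B)$ is a $\mathcal C^*$-netbase if for every $B\in\mathcal B$, every $x\in X$, every neighborhood $O_x$ of $x$ and every $C\in\mathcal C$ accumulating at $x$ there is $E\in\mathcal E$ such that $E\subset B$, $E[x]\subset O_x$ and $E[x]\cap C$ is infinite. It is a $\mathcal C^{**}$-netbase if for every $B\in\mathcal B$ and every $C\in\mathcal C$ accumulating at some point of $X$ there are $E\in\mathcal E$ and $x\in X$ such that $E\subset B$ and $E[x]\cap C$ is infinite. It is countable if $\mathcal E$ is countable, and locally (quasi-)uniform if $\mathcal B$ is so. Finally, $\mathsf{cs}$ is the family of all infinite sets of the form $\{x_n:n\in\omega\}$ for a convergent sequence $(x_n)_{n\in\omega}$ in $X$, and $\mathsf{ccs}$ is the family of all countable subsets of $X$ with countably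 compact closure. *Classes of spaces.* A family of subsets of $X$ is discrete if each point of $X$ has a neighborhood that meets at most one member of the family; a family $\mathcal F$ is strongly discrete if each $F\in\mathcal F$ has an open neighborhood $U_F$ such that the indexed family $(U_F)_{F\in\mathcal F}$ is discrete; $\mathcal F$ is (strongly) $\sigma$-discrete if it is a countable union of (strongly) discrete families. A network is a family $\mathcal N$ of subsets of $X$ such that for every open $U\subset X$ and $x\in U$ there is $N\in\mathcal N$ with $x\in N\subset U$; for a family $\mathcal C$ of subsets of $X$, a $\mathcal C$-network is a family $\mathcal N$ such that for every $C\in\mathcal C$ and every open $U\supset C$ there is $N\in\mathcal N$ with $C\subset N\subset U$. A sequence $(x_n)_{n\in\omega}$ accumulates at $y$ if every neighborhood of $y$ contains $x_n$ for infinitely many $n$. A topological space $X$ is - a closed-$\bar G_\delta$ space if every closed $F\subset X$ can be written as $F=\bigcap_{n\in\omega}W_n=\bigcap_{n\in\omega}\overline{W_n}$ for some open sets $W_n\subset X$; - collectionwise normal if each discrete family of closed sets in $X$ is strongly discrete; - a strong $\sigma$-space if $X$ is a regular $T_0$-space with a strongly $\sigma$-discrete network; - a $\Sigma$-space if $X$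 is a regular $T_0$-space with a $\sigma$-discrete $\mathcal C$-network for some cover $\mathcal C$ of $X$ by closed countably compact subspaces; - an $M$-space if $X$ is a regular $T_0$-space admitting a sequence $(\mathcal U_n)_{n\in\omega}$ of open covers such that each $\mathcal U_{n+1}$ star-refines $\mathcal U_n$ (for every $V\in\mathcal U_{n+1}$ the union of all members of $\mathcal U_{n+1}$ meeting $V$ is contained in some $U\in\mathcal U_n$) and, for every $x\in X$, every sequence $(x_n)_{n\in\omega}$ such that for every $n$ some member of $\mathcal U_n$ contains both $x$ and $x_n$ accumulates at some point of $X$; - a $q$-space if every $x\in X$ has a sequence of neighborhoods $(U_n)_{n\in\omega}$ such that every sequence $(x_n)\in\prod_{n\in\omega}U_n$ accumulates at some point of $X$. -/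

import Mathlib

namespace Netbase

open Set Filter Topology

variable {X : Type*}

/-! ### Entourage bases. The ball `U[x] = {y | (x, y) ∈ U}` is `UniformSpace.ball x U`. -/

/-- An entourage on a set: a subset of the square that contains the diagonal. -/
def IsEntourage (U : SetRel X X) : Prop :=
  ∀ x : X, (x, x) ∈ U

/-- A family of entourages is an entourage base for the topological space `X` if it is downward
directed and, at every point `x`, its balls at `x` form a neighborhood base at `x`. -/
structure IsEntourageBase [TopologicalSpace X] (B : Set (SetRel X X)) : Prop where
  entourage : ∀ U ∈ B, IsEntourage U
  directed : ∀ U ∈ B, ∀ V ∈ B, ∃ W ∈ B, W ⊆ U ∩ V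
  nhds_basis : ∀ x : X, (𝓝 x).HasBasis (fun U : SetRel X X => U ∈ B)
    (fun U => UniformSpace.ball x U)

/-- Every neighborhood of every point `x` contains `(U U)[x]` for some `U` in the family. -/
def IsLocallyQuasiUniform [TopologicalSpace X] (B : Set (SetRel X X)) : Prop :=
  ∀ x : X, ∀ O ∈ 𝓝 x, ∃ U ∈ B, UniformSpace.ball x (U.comp U) ⊆ O

/-- Every neighborhood of every point `x` contains `(U U⁻¹ U)[x]` for some `U` in the family. -/
def IsLocallyUniform [TopologicalSpace X] (B : Set (SetRel X X)) : Prop :=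
  ∀ x : X, ∀ O ∈ 𝓝 x, ∃ U ∈ B, UniformSpace.ball x ((U.comp U.inv).comp U) ⊆ O

/-! ### Networks and netbases -/

/-- The set `A` accumulates at `x`: each neighborhood of `x` contains infinitely many points
of `A`. -/
def AccumulatesAt [TopologicalSpace X] (A : Set X) (x : X) : Prop :=
  ∀ O ∈ 𝓝 x, (O ∩ A).Infinite

/-- The family `cs` of convergent sequences: infinite sets that are the set of values of some
convergent sequence of points. -/
def cs (X : Type*) [TopologicalSpace X] : Set (Set X) :=
  {A | A.Infinite ∧ ∃ (s : ℕ → X) (x : X), Tendsto s atTop (𝓝 x) ∧ A = range s}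

/-- The family `ccs` of countable sets with countably compact closure. -/
def ccs (X : Type*) [TopologicalSpace X] : Set (Set X) :=
  {A | A.Countable ∧ IsCountablyCompact (closure A)}

/-- `N` is a `C*`-network at the point `x`. -/
def IsStarNetworkAt [TopologicalSpace X] (C N : Set (Set X)) (x : X) : Prop :=
  ∀ O ∈ 𝓝 x, ∀ A ∈ C, AccumulatesAt A x → ∃ S ∈ N, x ∈ S ∧ S ⊆ O ∧ (S ∩ A).Infinite

/-- The pair `(E, B)` is a `C*`-netbase for `X`. -/
structure IsStarNetbase [TopologicalSpace X] (C : Set (Set X)) (E B : Set (SetRel X X)) :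
    Prop where
  entourage : ∀ U ∈ E, IsEntourage U
  base : IsEntourageBase B
  network : ∀ V ∈ B, ∀ x : X,
    IsStarNetworkAt C {S | ∃ U ∈ E, U ⊆ V ∧ S = UniformSpace.ball x U} x

/-- The pair `(E, B)` is a `C**`-netbase for `X`. -/
structure IsStarStarNetbase [TopologicalSpace X] (C : Set (Set X)) (E B : Set (SetRel X X)) :
    Prop where
  entourage : ∀ U ∈ E, IsEntourage U
  base : IsEntourageBase B
  network : ∀ V ∈ B, ∀ A ∈ C, (∃ x : X, AccumulatesAt A x) →
    ∃ U ∈ E, U ⊆ V ∧ ∃ x : X, (UniformSpace.ball x U ∩ A).Infinite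

/-- `X` has a countable locally uniform `cs*`-netbase. -/
def HasCountableLocallyUniformCsStarNetbase (X : Type*) [TopologicalSpace X] : Prop :=
  ∃ E B : Set (SetRel X X), E.Countable ∧ IsLocallyUniform B ∧ IsStarNetbase (cs X) E B

/-- `X` has a countable locally quasi-uniform `cs*`-netbase. -/
def HasCountableLocallyQuasiUniformCsStarNetbase (X : Type*) [TopologicalSpace X] : Prop :=
  ∃ E B : Set (SetRel X X), E.Countable ∧ IsLocallyQuasiUniform B ∧ IsStarNetbase (cs X) E B

/-- `X` has a countable locally uniform `ccs**`-netbase. -/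
def HasCountableLocallyUniformCcsStarStarNetbase (X : Type*) [TopologicalSpace X] : Prop :=
  ∃ E B : Set (SetRel X X), E.Countable ∧ IsLocallyUniform B ∧ IsStarStarNetbase (ccs X) E B

/-! ### Discrete families and collectionwise normality -/

/-- An indexed family of sets is discrete: each point has a neighborhood that meets the sets of
the family for at most one index. -/
def IsDiscreteFamily [TopologicalSpace X] {ι : Type*} (A : ι → Set X) : Prop :=
  ∀ x : X, ∃ O ∈ 𝓝 x, {i | (O ∩ A i).Nonempty}.Subsingleton

/-- A discrete family (given as a set of sets). -/
def IsDiscrete [TopologicalSpace X] (F : Set (Set X)) : Prop :=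
  IsDiscreteFamily (fun S : F => (S : Set X))

/-- A strongly discrete family: its members have open neighborhoods that form a discrete family
indexed by the members. -/
def IsStronglyDiscrete [TopologicalSpace X] (F : Set (Set X)) : Prop :=
  ∃ U : F → Set X, (∀ S : F, IsOpen (U S) ∧ (S : Set X) ⊆ U S) ∧ IsDiscreteFamily U

def IsSigmaDiscrete [TopologicalSpace X] (F : Set (Set X)) : Prop :=
  ∃ G : ℕ → Set (Set X), F = ⋃ i, G i ∧ ∀ i, IsDiscrete (G i)

def IsStronglySigmaDiscrete [TopologicalSpace X] (F : Set (Set X)) : Prop :=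
  ∃ G : ℕ → Set (Set X), F = ⋃ i, G i ∧ ∀ i, IsStronglyDiscrete (G i)

/-- Each discrete family of closed sets is strongly discrete. -/
def CollectionwiseNormal (X : Type*) [TopologicalSpace X] : Prop :=
  ∀ F : Set (Set X), (∀ S ∈ F, IsClosed S) → IsDiscrete F → IsStronglyDiscrete F

/-! ### Classes of spaces -/

/-- `F` is the intersection of a sequence of open sets and also of their closures. -/
def IsBarGδ [TopologicalSpace X] (F : Set X) : Prop :=
  ∃ W : ℕ → Set X, (∀ n, IsOpen (W n)) ∧ F = ⋂ n, W n ∧ F = ⋂ n, closure (W n)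

def ClosedBarGδSpace (X : Type*) [TopologicalSpace X] : Prop :=
  ∀ F : Set X, IsClosed F → IsBarGδ F

/-- A network of the topological space `X`. -/
def IsNetwork [TopologicalSpace X] (N : Set (Set X)) : Prop :=
  ∀ U : Set X, IsOpen U → ∀ x ∈ U, ∃ S ∈ N, x ∈ S ∧ S ⊆ U

/-- A `C`-network: each open neighborhood of each set of `C` contains a member of `N` that
contains this set. -/
def IsNetworkFor [TopologicalSpace X] (C N : Set (Set X)) : Prop :=
  ∀ A ∈ C, ∀ U : Set X, IsOpen U → A ⊆ U → ∃ S ∈ N, A ⊆ S ∧ S ⊆ U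

/-- A strong `σ`-space: a regular `T₀`-space with a strongly `σ`-discrete network. -/
structure StrongSigmaSpace (X : Type*) [TopologicalSpace X] : Prop where
  regular : RegularSpace X
  t0 : T0Space X
  network : ∃ N : Set (Set X), IsStronglySigmaDiscrete N ∧ IsNetwork N

/-- A `Σ`-space: a regular `T₀`-space with a `σ`-discrete `C`-network for some cover `C` by closed
countably compact subspaces. -/
structure BigSigmaSpace (X : Type*) [TopologicalSpace X] : Prop where
  regular : RegularSpace X
  t0 : T0Space X
  network : ∃ C N : Set (Set X), ⋃₀ C = univ ∧ (∀ K ∈ C, IsClosed K ∧ IsCountablyCompact K) ∧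
    IsSigmaDiscrete N ∧ IsNetworkFor C N

/-- The star of the set `A` with respect to the family `U`. -/
def coverStar (A : Set X) (U : Set (Set X)) : Set X :=
  ⋃₀ {S ∈ U | (S ∩ A).Nonempty}

/-- `V` star-refines `U`. -/
def StarRefines (V U : Set (Set X)) : Prop :=
  ∀ S ∈ V, ∃ T ∈ U, coverStar S V ⊆ T

/-- An `M`-space: a regular `T₀`-space with a sequence of open covers, each star-refining the
previous one, such that any sequence of points of the consecutive stars of a point accumulates
somewhere (every neighborhood of some `y` contains `s n` for infinitely many `n`). -/
structure MSpace (X : Type*) [TopologicalSpace X] : Prop where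
  regular : RegularSpace X
  t0 : T0Space X
  covers : ∃ U : ℕ → Set (Set X),
    (∀ n, (∀ S ∈ U n, IsOpen S) ∧ ⋃₀ U n = univ) ∧
    (∀ n, StarRefines (U (n + 1)) (U n)) ∧
    ∀ (x : X) (s : ℕ → X), (∀ n, s n ∈ coverStar {x} (U n)) → ∃ y : X, MapClusterPt y atTop s

/-- A `q`-space: each point `x` has a sequence of neighborhoods such that every sequence of points
chosen from the consecutive neighborhoods accumulates somewhere. -/
def QSpace (X : Type*) [TopologicalSpace X] : Prop :=
  ∀ x : X, ∃ U : ℕ → Set X, (∀ n, U n ∈ 𝓝 x) ∧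
    ∀ s : ℕ → X, (∀ n, s n ∈ U n) → ∃ y : X, MapClusterPt y atTop s

end Netbase

namespace Netbase

open Set Filter Topology

variable {X : Type*} [TopologicalSpace X]

/-! ### Discrete families -/

/-! In a metric space the relations `dist x y < (1 / 2) ^ n` serve as both halves of every netbase
required, and Stone's well-ordering construction gives a strongly σ-discrete network; this yields
all the conditions from metrizability.

For the converse, fix `V` in the entourage base and consider finite unions `R` of members of the
countable family that lie in `V`. If no such `R[x]` were a neighborhood of `x` in a first-countable
space, a sequence escaping them one by one would converge to `x`, contrary to the `cs*` property.
Under `ccs**` in a `q`-space the same diagonal argument shows that finitely many stars of one `R`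
cover a neighborhood of `x`. Discarding the stars whose closures miss `x` leaves the star hull,
still a neighborhood (`IsStarStarNetbase.exists_starHull_mem_nhds`).

Interiors of star hulls thus give countably many open families, and local uniformity keeps their
stars small. One such family may cover only an open `G`. If `G` is exhausted by open `M n` with
closures in `G`, adjoining the complement of `closure (M n)` gives a cover of `X` without changing
stars inside `M n`. The result is a strong development, and Moore's theorem applies
(`metrizable_of_starStarNetbase`). Conditions 2, 5 and 6 supply the exhaustion, relative to points,
to the kernels of an `M`-space, or to the cover of a `Σ`-space; countable compactness places each
such set in a single `G`. Condition 4 implies 6. Under condition 3 the network and the finite unions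
give a σ-discrete base directly, so Bing's theorem suffices. -/

theorem IsDiscreteFamily.mono {ι : Type*} {A B : ι → Set X} (hB : IsDiscreteFamily B)
    (h : ∀ i, A i ⊆ B i) : IsDiscreteFamily A := fun x =>
  let ⟨O, hO, hs⟩ := hB x
  ⟨O, hO, hs.anti fun i hi => hi.mono (inter_subset_inter_right O (h i))⟩

theorem IsDiscreteFamily.locallyFinite {ι : Type*} {A : ι → Set X} (hA : IsDiscreteFamily A) :
    LocallyFinite A := fun x =>
  let ⟨O, hO, hs⟩ := hA x
  ⟨O, hO, by simpa only [inter_comm] using hs.finite⟩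

theorem IsDiscreteFamily.disjoint {ι : Type*} {A : ι → Set X} (hA : IsDiscreteFamily A)
    {i j : ι} (hij : i ≠ j) : Disjoint (A i) (A j) :=
  Set.disjoint_left.2 fun x hi hj =>
    let ⟨_, hO, hs⟩ := hA x
    hij (hs ⟨x, mem_of_mem_nhds hO, hi⟩ ⟨x, mem_of_mem_nhds hO, hj⟩)

/-- In a normal space, a disjoint open expansion of a discrete family of closed sets can be shrunk
to a discrete one. -/
theorem exists_discrete_expansion [NormalSpace X] {ι : Type*} {F U : ι → Set X}
    (hF : ∀ i, IsClosed (F i)) (hd : IsDiscreteFamily F) (hU : ∀ i, IsOpen (U i))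
    (hFU : ∀ i, F i ⊆ U i) (hdisj : ∀ i j, i ≠ j → Disjoint (U i) (U j)) :
    ∃ V : ι → Set X, (∀ i, IsOpen (V i) ∧ F i ⊆ V i ∧ V i ⊆ U i) ∧ IsDiscreteFamily V := by
  obtain ⟨V, hVo, hFV, hVU⟩ := normal_exists_closure_subset (hd.locallyFinite.isClosed_iUnion hF)
    (isOpen_iUnion hU) (iUnion_mono hFU)
  refine ⟨fun i => U i ∩ V, fun i => ⟨(hU i).inter hVo,
    subset_inter (hFU i) ((subset_iUnion F i).trans hFV), inter_subset_left⟩, fun x => ?_⟩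
  by_cases hx : x ∈ closure V
  · obtain ⟨i, hi⟩ := mem_iUnion.1 (hVU hx)
    have key : ∀ j, (U i ∩ (U j ∩ V)).Nonempty → i = j := fun j ⟨z, hz, hz', _⟩ => by
      by_contra hij
      exact Set.disjoint_left.1 (hdisj i j hij) hz hz'
    exact ⟨U i, (hU i).mem_nhds hi, fun j hj k hk => (key j hj).symm.trans (key k hk)⟩
  · refine ⟨(closure V)ᶜ, isClosed_closure.isOpen_compl.mem_nhds hx, fun j hj => ?_⟩
    obtain ⟨z, hz, -, hz'⟩ := hj
    exact absurd (subset_closure hz') hz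

/-! ### Metrization theorems -/

/-- A normal space is metrizable as soon as it has countably many discrete families of pairs of a
closed set and an open neighborhood of it that separate points from closed sets. -/
theorem metrizable_of_discrete_pairs [T0Space X] [NormalSpace X] {κ : Type*} [Countable κ]
    {ι : κ → Type*} (F U : ∀ k, ι k → Set X) (hF : ∀ k i, IsClosed (F k i))
    (hU : ∀ k i, IsOpen (U k i)) (hFU : ∀ k i, F k i ⊆ U k i)
    (hd : ∀ k, IsDiscreteFamily (U k))
    (hb : ∀ x : X, ∀ O ∈ 𝓝 x, ∃ k i, x ∈ F k i ∧ U k i ⊆ O) :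
    TopologicalSpace.MetrizableSpace X := by
  have hf : ∀ k i, ∃ f : C(X, ℝ), EqOn f 0 (U k i)ᶜ ∧ EqOn f 1 (F k i) := fun k i =>
    let ⟨f, h0, h1, _⟩ := exists_continuous_zero_one_of_isClosed (hU k i).isClosed_compl (hF k i)
      (disjoint_compl_left_iff_subset.2 (hFU k i))
    ⟨f, h0, h1⟩
  choose f hf0 hf1 using hf
  -- Discreteness leaves at most one nonzero coordinate per `k` near a point, so `φ` is continuous
  -- even for uniform convergence in `i`; countability of `κ` keeps the product pseudometrizable.
  let φ : X → ∀ k, UniformFun (ι k) ℝ := fun x k => UniformFun.ofFun fun i => f k i x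
  have hφ : Continuous φ := by
    refine continuous_pi fun k => continuous_iff_continuousAt.2 fun x => ?_
    refine UniformFun.tendsto_iff_tendstoUniformly.2
      (Metric.tendstoUniformly_iff.2 fun ε hε => ?_)
    obtain ⟨O, hO, hs⟩ := hd k x
    have key : ∀ i, ∀ᶠ y in 𝓝 x, dist (f k i x) (f k i y) < ε := fun i =>
      (((f k i).continuous.tendsto x).eventually (Metric.ball_mem_nhds (f k i x) hε)).mono
        fun _ hy => Metric.mem_ball'.1 hy
    rcases hs.eq_empty_or_singleton with h | ⟨i₀, h⟩
    · filter_upwards [hO] with y hy i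
      have h0 : ∀ z ∈ O, f k i z = 0 := fun z hz => hf0 k i fun hzU => by
        have : i ∈ (∅ : Set (ι k)) := h ▸ ⟨z, hz, hzU⟩
        exact this
      show dist (f k i x) (f k i y) < ε
      rw [h0 x (mem_of_mem_nhds hO), h0 y hy, dist_self]
      exact hε
    · filter_upwards [hO, key i₀] with y hy hy' i
      show dist (f k i x) (f k i y) < ε
      by_cases hi : i = i₀
      · exact hi ▸ hy'
      have h0 : ∀ z ∈ O, f k i z = 0 := fun z hz => hf0 k i fun hzU => by
        have : i ∈ ({i₀} : Set (ι k)) := h ▸ ⟨z, hz, hzU⟩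
        exact hi this
      rw [h0 x (mem_of_mem_nhds hO), h0 y hy, dist_self]
      exact hε
  have hind : IsInducing φ := by
    refine isInducing_iff_nhds.2 fun x => le_antisymm (hφ.tendsto x).le_comap fun O hO => ?_
    obtain ⟨k, i, hx, hUO⟩ := hb x O hO
    have hev : Continuous fun g : ∀ k, UniformFun (ι k) ℝ => UniformFun.toFun (g k) i :=
      (UniformFun.uniformContinuous_eval ℝ i).continuous.comp (continuous_apply k)
    refine mem_comap.2 ⟨{g | 0 < UniformFun.toFun (g k) i},
      (isOpen_lt continuous_const hev).mem_nhds ?_, fun y hy => hUO ?_⟩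
    · show 0 < f k i x
      rw [hf1 k i hx]
      exact one_pos
    · by_contra hyU
      have hy' : 0 < f k i y := hy
      rw [hf0 k i hyU] at hy'
      exact lt_irrefl _ hy'
  have := hind.pseudoMetrizableSpace
  infer_instance

/-- Bing's metrization theorem: a regular `T₀`-space with a `σ`-discrete base is metrizable. -/
theorem metrizable_of_sigmaDiscrete_base [T0Space X] [RegularSpace X] {κ : Type*} [Countable κ]
    {ι : κ → Type*} (V : ∀ k, ι k → Set X) (hV : ∀ k i, IsOpen (V k i))
    (hd : ∀ k, IsDiscreteFamily (V k))
    (hb : ∀ x : X, ∀ O ∈ 𝓝 x, ∃ k i, x ∈ V k i ∧ V k i ⊆ O) :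
    TopologicalSpace.MetrizableSpace X := by
  have hb' : ∀ x : X, ∀ O ∈ 𝓝 x, ∃ k i, x ∈ V k i ∧ closure (V k i) ⊆ O := fun x O hO => by
    obtain ⟨P, hP, hPc, hPO⟩ := exists_mem_nhds_isClosed_subset hO
    obtain ⟨k, i, hx, hVP⟩ := hb x P hP
    exact ⟨k, i, hx, (closure_minimal hVP hPc).trans hPO⟩
  -- By local finiteness these are closed, and by `hb'` they exhaust `O` as `k` varies: this gives
  -- normality, and later the closed halves of the discrete pairs.
  let A : κ → Set X → Set X := fun k O => ⋃ i : {i // closure (V k i) ⊆ O}, closure (V k i)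
  have hlf : ∀ k O, LocallyFinite fun i : {i // closure (V k i) ⊆ O} => V k i := fun k O =>
    (hd k).locallyFinite.comp_injective Subtype.val_injective
  have hAc : ∀ k O, IsClosed (A k O) := fun k O =>
    (hlf k O).closure.isClosed_iUnion fun _ => isClosed_closure
  have hAO : ∀ k O, A k O ⊆ O := fun k O => iUnion_subset fun i => i.2
  have hsep : ∀ s t : Set X, IsClosed t → Disjoint s t → HasSeparatingCover s t := by
    intro s t ht hst
    rcases isEmpty_or_nonempty κ with hκ | hκ
    · have : s = ∅ := eq_empty_of_forall_notMem fun x _ =>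
        let ⟨k, _⟩ := hb x univ univ_mem
        hκ.elim k
      exact this ▸ hasSeparatingCover_empty_left t
    obtain ⟨e, he⟩ := exists_surjective_nat κ
    refine ⟨fun n => ⋃ i : {i // closure (V (e n) i) ⊆ tᶜ}, V (e n) i, fun x hx => ?_, fun n =>
      ⟨isOpen_iUnion fun i => hV _ _, ?_⟩⟩
    · obtain ⟨k, i, hxV, hVt⟩ := hb' x tᶜ (ht.isOpen_compl.mem_nhds (Set.disjoint_left.1 hst hx))
      obtain ⟨n, rfl⟩ := he k
      exact mem_iUnion.2 ⟨n, mem_iUnion.2 ⟨⟨i, hVt⟩, hxV⟩⟩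
    · rw [(hlf (e n) tᶜ).closure_iUnion]
      exact disjoint_left.2 fun x hx hxt => hAO (e n) tᶜ hx hxt
  have : NormalSpace X := ⟨fun s t hs ht hst => hasSeparatingCovers_iff_separatedNhds.1
    ⟨hsep s t ht hst, hsep t s hs hst.symm⟩⟩
  refine metrizable_of_discrete_pairs (κ := κ × κ) (fun k i => A k.2 (V k.1 i))
    (fun k => V k.1) (fun k i => hAc _ _) (fun k => hV _) (fun k i => hAO _ _) (fun k => hd _)
    fun x O hO => ?_
  obtain ⟨k, i, hx, hVO⟩ := hb x O hO
  obtain ⟨m, j, hx', hcl⟩ := hb' x _ ((hV k i).mem_nhds hx)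
  exact ⟨(k, m), i, mem_iUnion.2 ⟨⟨j, hcl⟩, subset_closure hx'⟩, hVO⟩

theorem mem_coverStar {Y : Type*} {A : Set Y} {W : Set (Set Y)} {z : Y} :
    z ∈ coverStar A W ↔ ∃ T ∈ W, z ∈ T ∧ (T ∩ A).Nonempty :=
  ⟨fun ⟨T, ⟨hT, hA⟩, hz⟩ => ⟨T, hT, hz, hA⟩, fun ⟨T, hT, hz, hA⟩ => ⟨T, ⟨hT, hA⟩, hz⟩⟩

theorem mem_coverStar_singleton {Y : Type*} {x : Y} {W : Set (Set Y)} {z : Y} :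
    z ∈ coverStar {x} W ↔ ∃ T ∈ W, z ∈ T ∧ x ∈ T := by
  simp [mem_coverStar]

/-- A discrete family of closed sets has a disjoint open expansion if the space has a strong
development. -/
theorem exists_disjoint_expansion {W : ℕ → Set (Set X)}
    (hW : ∀ n, ∀ S ∈ W n, IsOpen S) (hc : ∀ n, ⋃₀ W n = univ)
    (hs : ∀ x : X, ∀ O ∈ 𝓝 x, ∃ V ∈ 𝓝 x, ∃ n, coverStar V (W n) ⊆ O)
    {ι : Type*} {F : ι → Set X} (hF : ∀ i, IsClosed (F i)) (hd : IsDiscreteFamily F) :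
    ∃ U : ι → Set X, (∀ i, IsOpen (U i) ∧ F i ⊆ U i) ∧
      ∀ i j, i ≠ j → Disjoint (U i) (U j) := by
  have hT : ∀ n (x : X), ∃ T ∈ W n, x ∈ T := fun n x => by
    have : x ∈ ⋃₀ W n := hc n ▸ mem_univ x
    exact this
  -- The covers need not refine one another, so `V` is shrunk into a member of every `W m` with `m ≤
  -- n`. The values off `F i` are never used.
  have hV : ∀ (i : ι) (x : X), ∃ (V : Set X) (n : ℕ), x ∈ F i → IsOpen V ∧ x ∈ V ∧
      (∀ m ≤ n, ∃ T ∈ W m, V ⊆ T) ∧ ∀ j, j ≠ i → Disjoint (coverStar V (W n)) (F j) := by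
    intro i x
    by_cases hx : x ∈ F i
    swap
    · exact ⟨∅, 0, fun h => absurd h hx⟩
    have hcl : IsClosed (⋃ j : {j // j ≠ i}, F j) :=
      (hd.locallyFinite.comp_injective Subtype.val_injective).isClosed_iUnion fun j => hF j
    have hxn : x ∉ ⋃ j : {j // j ≠ i}, F j := fun h =>
      let ⟨j, hj⟩ := mem_iUnion.1 h
      Set.disjoint_left.1 (hd.disjoint j.2) hj hx
    obtain ⟨V, hVx, n, hVn⟩ := hs x _ (hcl.isOpen_compl.mem_nhds hxn)
    choose T hTW hxT using fun m => hT m x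
    refine ⟨interior V ∩ ⋂ m ∈ Iic n, T m, n, fun _ => ⟨isOpen_interior.inter
      ((finite_Iic n).isOpen_biInter fun m _ => hW m _ (hTW m)), ⟨mem_interior_iff_mem_nhds.2 hVx,
      mem_iInter₂.2 fun m _ => hxT m⟩, fun m hm => ⟨T m, hTW m, fun z hz =>
      mem_iInter₂.1 hz.2 m hm⟩, fun j hj => Set.disjoint_left.2 fun z hz hzj => ?_⟩⟩
    obtain ⟨S, hS, hzS, p, hpS, hp⟩ := mem_coverStar.1 hz
    exact hVn (mem_coverStar.2 ⟨S, hS, hzS, p, hpS, interior_subset hp.1⟩)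
      (mem_iUnion.2 ⟨⟨j, hj⟩, hzj⟩)
  choose V n hVn using hV
  refine ⟨fun i => ⋃ x ∈ F i, V i x, fun i => ⟨isOpen_biUnion fun x hx => (hVn i x hx).1,
    fun x hx => mem_biUnion hx (hVn i x hx).2.1⟩, fun i j hij => ?_⟩
  -- If the two sets met, the member of `W (n i x)` containing `V j y` would put `y` in the star of
  -- `V i x`, which misses `F j`.
  have key : ∀ i j, i ≠ j → ∀ x ∈ F i, ∀ y ∈ F j, n i x ≤ n j y → Disjoint (V i x) (V j y) := by
    intro i j hij x hx y hy hle
    obtain ⟨-, -, -, hdx⟩ := hVn i x hx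
    obtain ⟨-, hyV, hTy, -⟩ := hVn j y hy
    obtain ⟨T, hTW, hVT⟩ := hTy _ hle
    exact Set.disjoint_left.2 fun z hz hz' => Set.disjoint_left.1 (hdx j hij.symm)
      (mem_coverStar.2 ⟨T, hTW, hVT hyV, z, hVT hz', hz⟩) hy
  refine disjoint_iUnion₂_left.2 fun x hx => disjoint_iUnion₂_right.2 fun y hy => ?_
  rcases le_total (n i x) (n j y) with h | h
  · exact key i j hij x hx y hy h
  · exact (key j i hij.symm y hy x hx h).symm

/-- Moore's metrization theorem: a `T₀`-space with a strong development is metrizable. -/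
theorem metrizable_of_strong_development [T0Space X] {W : ℕ → Set (Set X)}
    (hW : ∀ n, ∀ S ∈ W n, IsOpen S) (hc : ∀ n, ⋃₀ W n = univ)
    (hs : ∀ x : X, ∀ O ∈ 𝓝 x, ∃ V ∈ 𝓝 x, ∃ n, coverStar V (W n) ⊆ O) :
    TopologicalSpace.MetrizableSpace X := by
  have hT : ∀ n (x : X), ∃ T ∈ W n, x ∈ T := fun n x => by
    have : x ∈ ⋃₀ W n := hc n ▸ mem_univ x
    exact this
  have hnormal : NormalSpace X := by
    refine ⟨fun s t hs' ht hst => ?_⟩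
    obtain ⟨U, hU, hdisj⟩ := exists_disjoint_expansion hW hc hs
      (F := fun b : Bool => cond b s t) (Bool.rec ht hs') fun x => by
        by_cases hx : x ∈ s
        · refine ⟨tᶜ, ht.isOpen_compl.mem_nhds (Set.disjoint_left.1 hst hx), ?_⟩
          rintro (_ | _) hi (_ | _) hj <;> simp_all
        · refine ⟨sᶜ, hs'.isOpen_compl.mem_nhds hx, ?_⟩
          rintro (_ | _) hi (_ | _) hj <;> simp_all
    exact ⟨U true, U false, (hU true).1, (hU false).1, (hU true).2, (hU false).2,
      hdisj _ _ (by simp)⟩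
  -- Stone's trick: a member of `W k.2` meeting `F k s` lies in `s`, hence misses `F k s'` for every
  -- later `s'`.
  let F : ∀ k : ℕ × ℕ, W k.1 → Set X := fun k s =>
    {x | (∀ T ∈ W k.2, x ∈ T → T ⊆ s) ∧ ∀ s' : W k.1, WellOrderingRel s' s → x ∉ s'.1}
  have hFs : ∀ k s, F k s ⊆ s := fun k s x hx =>
    let ⟨T, hTW, hxT⟩ := hT k.2 x
    hx.1 T hTW hxT hxT
  have hFc : ∀ k s, IsClosed (F k s) := fun k s => by
    have : F k s = (⋃₀ {T ∈ W k.2 | ¬ T ⊆ s})ᶜ ∩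
        (⋃ s' : {s' : W k.1 // WellOrderingRel s' s}, s'.1.1)ᶜ := by
      ext x
      simp only [F, mem_ofPred_eq, mem_inter_iff, mem_compl_iff, mem_sUnion, mem_iUnion,
        not_exists, not_and, Subtype.forall, and_imp]
      exact and_congr ⟨fun h T hT hTs hx => hTs (h T hT hx),
        fun h T hT hx => by_contra fun hTs => h T hT hTs hx⟩ Iff.rfl
    rw [this]
    exact (isOpen_sUnion fun T hT => hW _ T hT.1).isClosed_compl.inter
      (isOpen_iUnion fun s' => hW _ _ s'.1.2).isClosed_compl
  have hFd : ∀ k, IsDiscreteFamily (F k) := fun k x => by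
    obtain ⟨T, hTW, hxT⟩ := hT k.2 x
    refine ⟨T, (hW _ T hTW).mem_nhds hxT, ?_⟩
    rintro s ⟨y, hyT, hy⟩ s' ⟨y', hyT', hy'⟩
    rcases trichotomous_of WellOrderingRel s s' with h | h | h
    · exact absurd (hy.1 T hTW hyT hyT') (hy'.2 s h)
    · exact h
    · exact absurd (hy'.1 T hTW hyT' hyT) (hy.2 s' h)
  have hexp : ∀ k, ∃ V : W k.1 → Set X, (∀ s, IsOpen (V s) ∧ F k s ⊆ V s) ∧
      IsDiscreteFamily V := fun k => by
    obtain ⟨U, hU, hdisj⟩ := exists_disjoint_expansion hW hc hs (hFc k) (hFd k)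
    obtain ⟨V, hV, hVd⟩ := exists_discrete_expansion (hFc k) (hFd k) (fun i => (hU i).1)
      (fun i => (hU i).2) hdisj
    exact ⟨V, fun s => ⟨(hV s).1, (hV s).2.1⟩, hVd⟩
  choose V hV hVd using hexp
  refine metrizable_of_discrete_pairs F (fun k s => V k s ∩ s.1) hFc
    (fun k s => (hV k s).1.inter (hW _ _ s.2)) (fun k s => subset_inter (hV k s).2 (hFs k s))
    (fun k => (hVd k).mono fun s => inter_subset_left) fun x O hO => ?_
  obtain ⟨P, hP, n, hPn⟩ := hs x O hO
  have hne : {s : W n | x ∈ s.1}.Nonempty :=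
    let ⟨T, hTW, hxT⟩ := hT n x
    ⟨⟨T, hTW⟩, hxT⟩
  let s := (WellOrderingRel.isWellOrder (α := W n)).wf.min _ hne
  have hxs : x ∈ s.1 := WellFounded.min_mem _ _ hne
  obtain ⟨Q, hQ, m, hQm⟩ := hs x s.1 ((hW n _ s.2).mem_nhds hxs)
  refine ⟨(n, m), s, ⟨fun T hTW hxT z hz => hQm (mem_coverStar.2 ⟨T, hTW, hz, x, hxT,
    mem_of_mem_nhds hQ⟩), fun s' hs' hxs' => WellFounded.notMem_of_lt_min hs' hxs'⟩, ?_⟩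
  exact fun z hz => hPn (mem_coverStar.2 ⟨s, s.2, hz.2, x, hxs, mem_of_mem_nhds hP⟩)

end Netbase

namespace Netbase

open Set Filter Topology

variable {X : Type*}

/-! ### Balls of locally uniform entourage bases -/

/-- The union of all balls of `V` that meet `T`. -/
def ballStar (V : SetRel X X) (T : Set X) : Set X :=
  {z | ∃ t ∈ T, ∃ w, (w, t) ∈ V ∧ (w, z) ∈ V}

theorem ballStar_mono {V W : SetRel X X} (hVW : V ⊆ W) {S T : Set X} (hST : S ⊆ T) :
    ballStar V S ⊆ ballStar W T := fun _ ⟨t, ht, w, h, h'⟩ => ⟨t, hST ht, w, hVW h, hVW h'⟩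

theorem mem_ballStar_singleton_comm {V : SetRel X X} {s z : X} :
    z ∈ ballStar V {s} ↔ s ∈ ballStar V {z} := by
  simp only [ballStar, mem_singleton_iff, exists_eq_left, mem_ofPred_eq]
  exact exists_congr fun _ => and_comm

theorem iterate_ballStar_mono {V W : SetRel X X} (hVW : V ⊆ W) (k : ℕ) {S T : Set X}
    (hST : S ⊆ T) : (ballStar V)^[k] S ⊆ (ballStar W)^[k] T := by
  induction k with
  | zero => exact hST
  | succ k ih =>
    rw [Function.iterate_succ_apply', Function.iterate_succ_apply']
    exact ballStar_mono hVW ih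

/-- The star of `V[x]` under the balls of `V` is exactly `(V V⁻¹ V)[x]`. -/
theorem exists_ballStar_subset [TopologicalSpace X] {B : Set (SetRel X X)}
    (hl : IsLocallyUniform B) (x : X) {O : Set X} (hO : O ∈ 𝓝 x) :
    ∃ V ∈ B, ballStar V (UniformSpace.ball x V) ⊆ O :=
  let ⟨V, hV, h⟩ := hl x O hO
  ⟨V, hV, fun _ ⟨t, ht, w, hwt, hwz⟩ => h ⟨w, ⟨t, ht, hwt⟩, hwz⟩⟩

theorem exists_iterate_ballStar_subset [TopologicalSpace X] {B : Set (SetRel X X)}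
    (hB : IsEntourageBase B) (hl : IsLocallyUniform B) (k : ℕ) (x : X) {O : Set X}
    (hO : O ∈ 𝓝 x) : ∃ V ∈ B, (ballStar V)^[k] (UniformSpace.ball x V) ⊆ O := by
  induction k generalizing O with
  | zero => exact (hB.nhds_basis x).mem_iff.1 hO
  | succ k ih =>
    obtain ⟨W, hW, hWO⟩ := exists_ballStar_subset hl x hO
    obtain ⟨U, hU, hUW⟩ := ih ((hB.nhds_basis x).mem_of_mem hW)
    obtain ⟨V, hV, hVUW⟩ := hB.directed U hU W hW
    refine ⟨V, hV, ?_⟩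
    rw [Function.iterate_succ_apply']
    have hVU : V ⊆ U := hVUW.trans inter_subset_left
    exact (ballStar_mono (hVUW.trans inter_subset_right)
      ((iterate_ballStar_mono hVU k fun _ hz => hVU hz).trans hUW)).trans hWO

theorem IsLocallyUniform.isLocallyQuasiUniform [TopologicalSpace X] {B : Set (SetRel X X)}
    (hB : IsEntourageBase B) (hl : IsLocallyUniform B) : IsLocallyQuasiUniform B := fun x O hO =>
  let ⟨U, hU, h⟩ := hl x O hO
  ⟨U, hU, fun _ ⟨y, hxy, hyz⟩ => h ⟨y, ⟨y, hxy, hB.entourage U hU y⟩, hyz⟩⟩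

/-- If `z` lies in the closure of `V[x]`, the ball `V[z]` meets `V[x]`, so `z` belongs to the star
of `V[x]`. -/
theorem IsLocallyUniform.regularSpace [TopologicalSpace X] {B : Set (SetRel X X)}
    (hB : IsEntourageBase B) (hl : IsLocallyUniform B) : RegularSpace X := by
  refine RegularSpace.of_exists_mem_nhds_isClosed_subset fun x O hO => ?_
  obtain ⟨V, hV, h⟩ := exists_ballStar_subset hl x hO
  refine ⟨closure (UniformSpace.ball x V),
    mem_of_superset ((hB.nhds_basis x).mem_of_mem hV) subset_closure, isClosed_closure,
    fun z hz => h ?_⟩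
  obtain ⟨y, hzy, hxy⟩ := mem_closure_iff_nhds.1 hz _ ((hB.nhds_basis z).mem_of_mem hV)
  exact ⟨y, hxy, z, hzy, hB.entourage V hV z⟩

/-! ### Sequences -/

theorem infinite_range_and_accumulatesAt_of_tendsto [TopologicalSpace X] [T1Space X] {s : ℕ → X}
    {x : X} (hs : Tendsto s atTop (𝓝 x)) (hx : ∀ n, s n ≠ x) :
    (range s).Infinite ∧ AccumulatesAt (range s) x := by
  have h : AccumulatesAt (range s) x := fun O hO hfin => by
    have : O \ ((O ∩ range s) \ {x}) ∈ 𝓝 x := inter_mem hO <|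
      (hfin.subset sdiff_subset).isClosed.isOpen_compl.mem_nhds fun h => h.2 rfl
    obtain ⟨n, hn⟩ := (hs.eventually this).exists
    exact hn.2 ⟨⟨hn.1, mem_range_self n⟩, hx n⟩
  exact ⟨(h univ univ_mem).mono inter_subset_right, h⟩

theorem exists_cs_subset [TopologicalSpace X] [T1Space X] [FirstCountableTopology X] {A : Set X}
    {x : X} (hA : AccumulatesAt A x) : ∃ S ∈ cs X, S ⊆ A ∧ AccumulatesAt S x := by
  obtain ⟨u, hu⟩ := (𝓝 x).exists_antitone_basis
  have : ∀ n, ∃ y ∈ u n ∩ A, y ≠ x := fun n =>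
    let ⟨y, hy, hyx⟩ := (hA (u n) (hu.1.mem_of_mem trivial)).exists_notMem_finset {x}
    ⟨y, hy, by simpa using hyx⟩
  choose s hs hsx using this
  have hst : Tendsto s atTop (𝓝 x) := hu.tendsto fun n => (hs n).1
  have h := infinite_range_and_accumulatesAt_of_tendsto hst hsx
  exact ⟨range s, ⟨h.1, s, x, hst, rfl⟩, range_subset_iff.2 fun n => (hs n).2, h.2⟩

/-- A sequence of points of the consecutive sets `u n` has countably compact closure if every such
sequence has a cluster point and `closure (u (n + 1)) ⊆ u n`. -/
theorem isCountablyCompact_closure_range [TopologicalSpace X] [T1Space X] {u : ℕ → Set X}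
    (hu : ∀ n, closure (u (n + 1)) ⊆ u n)
    (hc : ∀ s : ℕ → X, (∀ n, s n ∈ u n) → ∃ y, MapClusterPt y atTop s) {a : ℕ → X}
    (ha : ∀ n, a n ∈ u n) : IsCountablyCompact (closure (range a)) := by
  have hanti : Antitone u := antitone_nat_of_succ_le fun n => subset_closure.trans (hu n)
  -- The tail is taken in `u (N + 1)` so that its closure still lies in `u N`.
  have hsplit : ∀ N, closure (range a) ⊆ a '' Iic N ∪ u N := fun N => by
    have : range a ⊆ a '' Iic N ∪ u (N + 1) := range_subset_iff.2 fun n => by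
      rcases le_or_gt n N with h | h
      · exact Or.inl ⟨n, h, rfl⟩
      · exact Or.inr (hanti h (ha n))
    refine (closure_mono this).trans ?_
    rw [closure_union, ((finite_Iic N).image a).isClosed.closure_eq]
    exact union_subset_union_right _ (hu N)
  refine IsCountablyCompact.of_seq_clusterPt fun z hz => ?_
  suffices ∃ y, MapClusterPt y atTop z by
    obtain ⟨y, hy⟩ := this
    refine ⟨y, ?_, hy⟩
    rw [← closure_closure]
    exact mem_closure_iff_clusterPt.2 (hy.clusterPt.mono (tendsto_principal.2 hz))
  by_cases h : ∃ N, ∃ᶠ k in atTop, z k ∈ a '' Iic N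
  · obtain ⟨N, hN⟩ := h
    have : ∃ i, ∃ᶠ k in atTop, z k = a i := by
      by_contra hno
      simp only [not_exists, not_frequently] at hno
      have := (eventually_all_finite (finite_Iic N)).2 fun i _ => hno i
      obtain ⟨k, ⟨i, hi, hik⟩, hk⟩ := (hN.and_eventually this).exists
      exact hk i hi hik.symm
    obtain ⟨i, hi⟩ := this
    exact ⟨a i, mapClusterPt_iff_frequently.2 fun s hs => hi.mono fun k hk =>
      hk ▸ mem_of_mem_nhds hs⟩
  · simp only [not_exists, not_frequently] at h
    have hev : ∀ N, ∀ᶠ k in atTop, z k ∈ u N := fun N => by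
      filter_upwards [hz, h N] with k hk hk'
      exact (hsplit N hk).resolve_left hk'
    obtain ⟨φ, hφ, hφu⟩ := extraction_forall_of_eventually hev
    obtain ⟨y, hy⟩ := hc (z ∘ φ) hφu
    exact ⟨y, hy.of_comp hφ.tendsto_atTop⟩

theorem QSpace.exists_regular_sequence [TopologicalSpace X] [RegularSpace X] (hq : QSpace X)
    (x : X) : ∃ u : ℕ → Set X, (∀ n, u n ∈ 𝓝 x) ∧ (∀ n, closure (u (n + 1)) ⊆ u n) ∧
      ∀ s : ℕ → X, (∀ n, s n ∈ u n) → ∃ y, MapClusterPt y atTop s := by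
  obtain ⟨U, hU, hUs⟩ := hq x
  have hP : ∀ (n : ℕ) (P : {P : Set X // P ∈ 𝓝 x}), ∃ Q : {P : Set X // P ∈ 𝓝 x},
      closure Q.1 ⊆ P.1 ∩ U n := fun n P =>
    let ⟨Q, hQ, hQc, hQP⟩ := exists_mem_nhds_isClosed_subset (inter_mem P.2 (hU n))
    ⟨⟨Q, hQ⟩, hQc.closure_eq.subset.trans hQP⟩
  choose g hg using hP
  let u : ℕ → {P : Set X // P ∈ 𝓝 x} := fun n =>
    Nat.rec (g 0 ⟨univ, univ_mem⟩) (fun n P => g (n + 1) P) n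
  have hsucc : ∀ n, closure (u (n + 1)).1 ⊆ (u n).1 ∩ U (n + 1) := fun n => hg (n + 1) (u n)
  have hsub : ∀ n, (u n).1 ⊆ U n := fun n => by
    cases n with
    | zero => exact subset_closure.trans ((hg 0 _).trans inter_subset_right)
    | succ n => exact subset_closure.trans ((hsucc n).trans inter_subset_right)
  exact ⟨fun n => (u n).1, fun n => (u n).2, fun n => (hsucc n).trans inter_subset_left,
    fun s hs => hUs s fun n => hsub n (hs n)⟩

theorem qSpace_of_firstCountable [TopologicalSpace X] [FirstCountableTopology X] : QSpace X :=
  fun x =>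
    let ⟨u, hu⟩ := (𝓝 x).exists_antitone_basis
    ⟨u, fun _ => hu.1.mem_of_mem trivial, fun _ hs => ⟨x, (hu.tendsto hs).mapClusterPt⟩⟩

/-! ### Finite unions of entourages -/

/-- The union of the diagonal and of finitely many members of a sequence of relations. -/
def finUnion (e : ℕ → SetRel X X) (t : Finset ℕ) : SetRel X X :=
  {p | p.1 = p.2 ∨ ∃ k ∈ t, p ∈ e k}

/-- The sequence `e` may list relations outside the netbase that are not entourages, and `t` may be
empty; hence the diagonal built into `finUnion`. -/
theorem diag_mem_finUnion (e : ℕ → SetRel X X) (t : Finset ℕ) (x : X) : (x, x) ∈ finUnion e t :=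
  Or.inl rfl

theorem finUnion_mono (e : ℕ → SetRel X X) {t t' : Finset ℕ} (h : t ⊆ t') :
    finUnion e t ⊆ finUnion e t' := fun _ hp => hp.imp_right fun ⟨k, hk, hp⟩ => ⟨k, h hk, hp⟩

open Classical in
/-- The indices `k ≤ n` such that `e k ⊆ V`. -/
noncomputable def indicesBelow (e : ℕ → SetRel X X) (V : SetRel X X) (n : ℕ) : Finset ℕ :=
  (Finset.range (n + 1)).filter fun k => e k ⊆ V

theorem mem_indicesBelow {e : ℕ → SetRel X X} {V : SetRel X X} {n k : ℕ} :
    k ∈ indicesBelow e V n ↔ k ≤ n ∧ e k ⊆ V := by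
  simp [indicesBelow]

theorem indicesBelow_mono (e : ℕ → SetRel X X) (V : SetRel X X) {m n : ℕ} (h : m ≤ n) :
    indicesBelow e V m ⊆ indicesBelow e V n := fun _ hk =>
  let ⟨hkm, hkV⟩ := mem_indicesBelow.1 hk
  mem_indicesBelow.2 ⟨hkm.trans h, hkV⟩

theorem finUnion_union_subset {e : ℕ → SetRel X X} {V : SetRel X X} {t t' : Finset ℕ}
    (h : finUnion e t ⊆ V) (h' : finUnion e t' ⊆ V) : finUnion e (t ∪ t') ⊆ V := by
  rintro p (hp | ⟨k, hk, hp⟩)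
  · exact h (Or.inl hp)
  · rcases Finset.mem_union.1 hk with hk | hk
    exacts [h (Or.inr ⟨k, hk, hp⟩), h' (Or.inr ⟨k, hk, hp⟩)]

theorem finUnion_indicesBelow_subset {e : ℕ → SetRel X X} {V : SetRel X X} (hV : IsEntourage V)
    (n : ℕ) : finUnion e (indicesBelow e V n) ⊆ V := by
  rintro ⟨x, y⟩ (hp | ⟨k, hk, hp⟩)
  · obtain rfl : x = y := hp
    exact hV x
  · exact (mem_indicesBelow.1 hk).2 hp

/-- Otherwise points `s n → x` avoid the `n`-th finite union at `x`. The netbase gives some `e k ⊆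
V` whose ball at `x` contains infinitely many values of `s`, yet `s n` avoids it for all `n ≥ k`. -/
theorem IsStarNetbase.exists_finUnion_mem_nhds [TopologicalSpace X] [T1Space X]
    [FirstCountableTopology X] {E B : Set (SetRel X X)} (h : IsStarNetbase (cs X) E B)
    {e : ℕ → SetRel X X} (he : E ⊆ range e) (x : X) {V : SetRel X X} (hV : V ∈ B) :
    ∃ t, finUnion e t ⊆ V ∧ UniformSpace.ball x (finUnion e t) ∈ 𝓝 x := by
  by_contra! hno
  obtain ⟨u, hu⟩ := (𝓝 x).exists_antitone_basis
  have hVe := h.base.entourage V hV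
  have : ∀ n, ∃ y ∈ u n, y ∉ UniformSpace.ball x (finUnion e (indicesBelow e V n)) := fun n =>
    not_subset.1 fun hsub => hno _ (finUnion_indicesBelow_subset hVe n)
      (mem_of_superset (hu.1.mem_of_mem trivial) hsub)
  choose s hs hsn using this
  have hst : Tendsto s atTop (𝓝 x) := hu.tendsto hs
  obtain ⟨hinf, hacc⟩ := infinite_range_and_accumulatesAt_of_tendsto hst fun n hn =>
    hsn n (hn ▸ diag_mem_finUnion e _ _)
  obtain ⟨S, ⟨U, hUE, hUV, rfl⟩, -, -, hSinf⟩ :=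
    h.network V hV x univ univ_mem (range s) ⟨hinf, s, x, hst, rfl⟩ hacc
  obtain ⟨k, rfl⟩ := he hUE
  refine hSinf (((finite_Iio k).image s).subset ?_)
  rintro _ ⟨hz, n, rfl⟩
  have hnk : n < k := lt_of_not_ge fun hkn =>
    hsn n (Or.inr ⟨k, mem_indicesBelow.2 ⟨hkn, hUV⟩, hz⟩)
  exact ⟨n, hnk, rfl⟩

/-- A set accumulating at `x` contains a sequence converging to `x`, to which the `cs*` property
applies. -/
theorem IsStarNetbase.isStarStarNetbase [TopologicalSpace X] [T1Space X]
    [FirstCountableTopology X] {E B : Set (SetRel X X)} (h : IsStarNetbase (cs X) E B) :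
    IsStarStarNetbase (ccs X) E B where
  entourage := h.entourage
  base := h.base
  network V hV A _ := fun ⟨x, hx⟩ => by
    obtain ⟨S, hS, hSA, hSx⟩ := exists_cs_subset hx
    obtain ⟨_, ⟨U, hUE, hUV, rfl⟩, -, -, hinf⟩ := h.network V hV x univ univ_mem S hS hSx
    exact ⟨U, hUE, hUV, x, hinf.mono (inter_subset_inter_right _ hSA)⟩

/-! ### The covers generated by a netbase -/

/-- The union of the stars of `R` whose closures contain `x`. -/
def starHull [TopologicalSpace X] (R : SetRel X X) (x : X) : Set X :=
  {z | ∃ s, x ∈ closure (ballStar R {s}) ∧ z ∈ ballStar R {s}}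

theorem starHull_mono [TopologicalSpace X] {R R' : SetRel X X} (h : R ⊆ R') (x : X) :
    starHull R x ⊆ starHull R' x := fun _ ⟨s, hx, hz⟩ =>
  ⟨s, closure_mono (ballStar_mono h Subset.rfl) hx, ballStar_mono h Subset.rfl hz⟩

/-- The open sets `interior (starHull R x)`. -/
def hullCover [TopologicalSpace X] (R : SetRel X X) : Set (Set X) :=
  range fun x => interior (starHull R x)

theorem isOpen_of_mem_hullCover [TopologicalSpace X] {R : SetRel X X} {S : Set X}
    (hS : S ∈ hullCover R) : IsOpen S := by
  obtain ⟨x, rfl⟩ := hS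
  exact isOpen_interior

theorem sUnion_hullCover_mono [TopologicalSpace X] {R R' : SetRel X X} (h : R ⊆ R') :
    ⋃₀ hullCover R ⊆ ⋃₀ hullCover R' := by
  rintro z ⟨_, ⟨x, rfl⟩, hz⟩
  exact ⟨_, ⟨x, rfl⟩, interior_mono (starHull_mono h x) hz⟩

/-- The five stars form the chain `v, s, p, p', s', z`: the hull of `y` joins `v` to `z` through two
star centers `s`, `s'`, and points `p`, `p'` of their stars are chosen in the single ball `V[y]`. -/
theorem coverStar_hullCover_subset [TopologicalSpace X] {B : Set (SetRel X X)}
    (hB : IsEntourageBase B) {V R : SetRel X X} (hV : V ∈ B) (hR : R ⊆ V) (T : Set X) :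
    coverStar T (hullCover R) ⊆ (ballStar V)^[5] T := by
  intro z hz
  obtain ⟨_, ⟨y, rfl⟩, hzy, v, hvy, hvT⟩ := mem_coverStar.1 hz
  obtain ⟨s, hys, hvs⟩ := interior_subset hvy
  obtain ⟨s', hys', hzs'⟩ := interior_subset hzy
  have hyV := (hB.nhds_basis y).mem_of_mem hV
  obtain ⟨p, hyp, hps⟩ := mem_closure_iff_nhds.1 hys _ hyV
  obtain ⟨p', hyp', hps'⟩ := mem_closure_iff_nhds.1 hys' _ hyV
  have step : ∀ {k : ℕ} {a b : X}, a ∈ (ballStar V)^[k] T → b ∈ ballStar V {a} →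
      b ∈ (ballStar V)^[k + 1] T := fun {k a b} ha hb => by
    rw [Function.iterate_succ_apply']
    exact ballStar_mono Subset.rfl (singleton_subset_iff.2 ha) hb
  have toV : ∀ {a b : X}, a ∈ ballStar R {b} → a ∈ ballStar V {b} := fun h =>
    ballStar_mono hR Subset.rfl h
  have h1 := step (k := 0) hvT (mem_ballStar_singleton_comm.1 (toV hvs))
  have h2 := step h1 (toV hps)
  have h3 := step h2 (b := p') ⟨p, rfl, y, hyp, hyp'⟩
  exact step (step h3 (mem_ballStar_singleton_comm.1 (toV hps'))) (toV hzs')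

/-- In a `q`-space with a `ccs**`-netbase, every point `x` is interior to the star hull of `x`
for some finite union of entourages. -/
theorem IsStarStarNetbase.exists_starHull_mem_nhds [TopologicalSpace X] [T1Space X]
    [RegularSpace X] (hq : QSpace X) {E B : Set (SetRel X X)}
    (h : IsStarStarNetbase (ccs X) E B) {e : ℕ → SetRel X X} (he : E ⊆ range e) (x : X)
    {V : SetRel X X} (hV : V ∈ B) :
    ∃ t, finUnion e t ⊆ V ∧ starHull (finUnion e t) x ∈ 𝓝 x := by
  obtain ⟨u, hu, hucl, huc⟩ := hq.exists_regular_sequence x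
  have hanti : Antitone u := antitone_nat_of_succ_le fun n => subset_closure.trans (hucl n)
  have hVe := h.base.entourage V hV
  let R : ℕ → SetRel X X := fun n => finUnion e (indicesBelow e V n)
  have hR : ∀ {m n}, m ≤ n → R m ⊆ R n := fun hmn => finUnion_mono e (indicesBelow_mono e V hmn)
  suffices hfin : ∃ n, ∃ S : Finset X, u n ⊆ ⋃ s ∈ S, ballStar (R n) {s} by
    obtain ⟨n, S, hS⟩ := hfin
    refine ⟨indicesBelow e V n, finUnion_indicesBelow_subset hVe n, ?_⟩
    -- Near `x`, the finitely many stars whose closures miss `x` can be avoided.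
    have hne : ∀ s ∈ S, (closure (ballStar (R n) {s}))ᶜ ∪ {z | x ∈ closure (ballStar (R n) {s})} ∈
        𝓝 x := fun s _ => by
      by_cases hx : x ∈ closure (ballStar (R n) {s})
      · exact univ_mem' fun _ => Or.inr hx
      · exact mem_of_superset (isClosed_closure.isOpen_compl.mem_nhds hx) subset_union_left
    filter_upwards [hu n, (Finset.iInter_mem_sets S).2 hne] with z hz hz'
    obtain ⟨s, hs, hzs⟩ := mem_iUnion₂.1 (hS hz)
    exact ⟨s, (mem_iInter₂.1 hz' s hs).resolve_left fun h => h (subset_closure hzs), hzs⟩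
  by_contra! hno
  -- Each chosen point carries its index; the indices increase strictly, so the `n`-th index is at
  -- least `n`.
  obtain ⟨f, hfP, hfr⟩ := exists_seq_of_forall_finset_exists
    (fun p : ℕ × X => p.2 ∈ u p.1) (fun p q => p.1 < q.1 ∧ q.2 ∉ ballStar (R q.1) {p.2})
    fun S _ => by
      classical
      obtain ⟨a, ha, ha'⟩ := not_subset.1 (hno (S.sup Prod.fst + 1) (S.image Prod.snd))
      refine ⟨(S.sup Prod.fst + 1, a), ha, fun p hp => ⟨Nat.lt_succ_of_le
        (Finset.le_sup (f := Prod.fst) hp), fun hpa => ha' (mem_iUnion₂.2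
        ⟨p.2, Finset.mem_image_of_mem _ hp, hpa⟩)⟩⟩
  let a : ℕ → X := fun n => (f n).2
  have hmono : StrictMono fun n => (f n).1 := fun m n hmn => (hfr m n hmn).1
  have hau : ∀ n, a n ∈ u n := fun n => hanti (hmono.id_le n) (hfP n)
  have har : ∀ {m n}, m < n → a n ∉ ballStar (R n) {a m} := fun {m n} hmn hmem =>
    (hfr m n hmn).2 (ballStar_mono (hR (hmono.id_le n)) Subset.rfl hmem)
  have hinj : Function.Injective a := by
    have : ∀ {m n}, m < n → a m ≠ a n := fun {m n} hmn heq =>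
      har hmn ⟨a m, rfl, a m, diag_mem_finUnion e _ _, heq ▸ diag_mem_finUnion e _ _⟩
    exact fun m n hmn => by
      by_contra hne
      rcases lt_or_gt_of_ne hne with h | h
      exacts [this h hmn, this h hmn.symm]
  obtain ⟨y, hy⟩ := huc a hau
  have hacc : AccumulatesAt (range a) y := fun O hO => by
    have := Nat.frequently_atTop_iff_infinite.1 (mapClusterPt_iff_frequently.1 hy O hO)
    refine (this.image hinj.injOn).mono ?_
    rintro _ ⟨n, hn, rfl⟩
    exact ⟨hn, mem_range_self n⟩
  obtain ⟨U, hUE, hUV, w, hw⟩ := h.network V hV (range a)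
    ⟨countable_range a, isCountablyCompact_closure_range hucl huc hau⟩ ⟨y, hacc⟩
  obtain ⟨k, rfl⟩ := he hUE
  have hI : {n | a n ∈ UniformSpace.ball w (e k)}.Infinite := fun hfin => by
    refine hw ((hfin.image a).subset ?_)
    rintro _ ⟨hz, n, rfl⟩
    exact ⟨n, hz, rfl⟩
  -- Two terms lie in one ball of `e k`, which is part of `R n` because `n ≥ k`; the later term is
  -- then in the forbidden star of the earlier one.
  obtain ⟨m, hm, -⟩ := hI.exists_gt k
  obtain ⟨n, hn, hmn⟩ := hI.exists_gt (max m k)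
  have hk : ∀ {z}, z ∈ UniformSpace.ball w (e k) → (w, z) ∈ R n := fun hz =>
    Or.inr ⟨k, mem_indicesBelow.2 ⟨(le_max_right m k).trans hmn.le, hUV⟩, hz⟩
  exact har ((le_max_left m k).trans_lt hmn) ⟨a m, rfl, w, hk hm, hk hn⟩

/-- A regular `T₀` `q`-space with a countable locally uniform `ccs**`-netbase is metrizable if it
has a cover by countably compact sets `K x` such that open sets `G` are exhausted, with respect to
this cover, by sequences of open sets with closures in `G`. -/
theorem metrizable_of_starStarNetbase [TopologicalSpace X] [T0Space X] (hq : QSpace X)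
    (h : HasCountableLocallyUniformCcsStarStarNetbase X) (K : X → Set X)
    (hK : ∀ x, IsCountablyCompact (K x))
    (hG : ∀ G : Set X, IsOpen G → ∃ M : ℕ → Set X, (∀ n, IsOpen (M n) ∧ closure (M n) ⊆ G) ∧
      ∀ x, K x ⊆ G → ∃ n, x ∈ M n) :
    TopologicalSpace.MetrizableSpace X := by
  obtain ⟨E, B, hE, hl, hEB⟩ := h
  have := hl.regularSpace hEB.base
  obtain ⟨e, he⟩ := countable_iff_exists_subset_range.1 hE
  let R := finUnion e
  have hGo : ∀ t, IsOpen (⋃₀ hullCover (R t)) := fun t => isOpen_sUnion fun _ =>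
    isOpen_of_mem_hullCover
  choose M hM hKM using fun t => hG _ (hGo t)
  -- The extra member makes this a cover, since `closure (M t n)` lies in the union of the hull
  -- cover, and it is invisible to stars of subsets of `M t n`.
  let W : Finset ℕ × ℕ → Set (Set X) := fun p => insert (closure (M p.1 p.2))ᶜ (hullCover (R p.1))
  obtain ⟨φ, hφ⟩ := exists_surjective_nat (Finset ℕ × ℕ)
  refine metrizable_of_strong_development (W := fun n => W (φ n)) (fun n S hS => ?_)
    (fun n => eq_univ_of_forall fun z => ?_) fun x O hO => ?_
  · rcases hS with rfl | hS
    exacts [isClosed_closure.isOpen_compl, isOpen_of_mem_hullCover hS]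
  · by_cases hz : z ∈ closure (M (φ n).1 (φ n).2)
    · obtain ⟨S, hS, hzS⟩ := (hM _ _).2 hz
      exact ⟨S, Or.inr hS, hzS⟩
    · exact ⟨_, Or.inl rfl, hz⟩
  · obtain ⟨V, hV, hVO⟩ := exists_iterate_ballStar_subset hEB.base hl 5 x hO
    have hcov : K x ⊆ ⋃ t : {t // R t ⊆ V}, ⋃₀ hullCover (R t) := fun y _ =>
      let ⟨t, ht, hty⟩ := hEB.exists_starHull_mem_nhds hq he y hV
      mem_iUnion.2 ⟨⟨t, ht⟩, _, ⟨y, rfl⟩, mem_interior_iff_mem_nhds.2 hty⟩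
    have : Nonempty {t // R t ⊆ V} :=
      ⟨_, finUnion_indicesBelow_subset (hEB.base.entourage V hV) 0⟩
    -- There are only countably many finite index sets, so countable compactness is enough.
    obtain ⟨⟨t, ht⟩, hKt⟩ := (hK x).elim_directed_cover
      (fun t : {t // R t ⊆ V} => ⋃₀ hullCover (R t)) (fun t => hGo t) hcov fun t t' =>
      ⟨⟨t.1 ∪ t'.1, finUnion_union_subset t.2 t'.2⟩,
        sUnion_hullCover_mono (finUnion_mono e Finset.subset_union_left),
        sUnion_hullCover_mono (finUnion_mono e Finset.subset_union_right)⟩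
    obtain ⟨n, hn⟩ := hKM t x hKt
    obtain ⟨m, hm⟩ := hφ (t, n)
    refine ⟨UniformSpace.ball x V ∩ M t n, inter_mem ((hEB.base.nhds_basis x).mem_of_mem hV)
      ((hM t n).1.mem_nhds hn), m, fun z hz => hVO ?_⟩
    obtain ⟨S, hS, hzS, y, hyS, hyV, hyM⟩ := mem_coverStar.1 hz
    rw [hm] at hS
    rcases hS with rfl | hS
    · exact absurd (subset_closure hyM) hyS
    · exact coverStar_hullCover_subset hEB.base hV ht _
        (mem_coverStar.2 ⟨S, hS, hzS, y, hyS, hyV⟩)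

end Netbase

namespace Netbase

open Set Filter Topology

variable {X : Type*} [TopologicalSpace X]

/-! ### Metrizability from countable netbases -/

theorem metrizable_of_closedBarGδ [T0Space X] [FirstCountableTopology X]
    (hX : ClosedBarGδSpace X) (h : HasCountableLocallyUniformCsStarNetbase X) :
    TopologicalSpace.MetrizableSpace X := by
  obtain ⟨E, B, hE, hl, hEB⟩ := h
  have := hl.regularSpace hEB.base
  refine metrizable_of_starStarNetbase qSpace_of_firstCountable
    ⟨E, B, hE, hl, hEB.isStarStarNetbase⟩ (fun x => {x})
    (fun _ => isCountablyCompact_singleton) fun G hG => ?_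
  obtain ⟨W, hW, hGW, hGW'⟩ := hX Gᶜ hG.isClosed_compl
  refine ⟨fun n => (closure (W n))ᶜ, fun n => ⟨isClosed_closure.isOpen_compl, ?_⟩,
    fun x hx => ?_⟩
  · refine (closure_minimal (compl_subset_compl.2 subset_closure) (hW n).isClosed_compl).trans ?_
    exact compl_subset_comm.1 (hGW.subset.trans (iInter_subset W n))
  · have : x ∉ ⋂ n, closure (W n) := fun hx' => (hGW' ▸ hx' : x ∈ Gᶜ) (hx rfl)
    simpa using this

theorem metrizable_of_strongSigma [FirstCountableTopology X] (hX : StrongSigmaSpace X)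
    (h : HasCountableLocallyQuasiUniformCsStarNetbase X) :
    TopologicalSpace.MetrizableSpace X := by
  have := hX.regular
  have := hX.t0
  obtain ⟨N, ⟨G, rfl, hG⟩, hN⟩ := hX.network
  choose U hU hUd using hG
  obtain ⟨E, B, hE, hl, hEB⟩ := h
  obtain ⟨e, he⟩ := countable_iff_exists_subset_range.1 hE
  -- With `S ⊆ V[x]` and the finite union inside `V`, this open enlargement of `S` lies in `(V
  -- V)[x]`.
  refine metrizable_of_sigmaDiscrete_base (κ := ℕ × Finset ℕ) (ι := fun p => G p.1)
    (fun p S => U p.1 S ∩ ⋃ x ∈ S.1, interior (UniformSpace.ball x (finUnion e p.2)))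
    (fun p S => (hU p.1 S).1.inter (isOpen_biUnion fun _ _ => isOpen_interior))
    (fun p => (hUd p.1).mono fun S => inter_subset_left) fun x O hO => ?_
  obtain ⟨V, hV, hVO⟩ := hl x O hO
  obtain ⟨t, htV, ht⟩ := hEB.exists_finUnion_mem_nhds he x hV
  obtain ⟨S, hS, hxS, hSV⟩ := hN _ isOpen_interior x
    (mem_interior_iff_mem_nhds.2 ((hEB.base.nhds_basis x).mem_of_mem hV))
  obtain ⟨n, hn⟩ := mem_iUnion.1 hS
  refine ⟨(n, t), ⟨S, hn⟩, ⟨(hU n ⟨S, hn⟩).2 hxS, mem_biUnion hxS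
    (mem_interior_iff_mem_nhds.2 ht)⟩, fun z hz => hVO ?_⟩
  obtain ⟨y, hy, hyz⟩ := mem_iUnion₂.1 hz.2
  have hxy : y ∈ UniformSpace.ball x V := interior_subset (hSV hy)
  have hyz' : z ∈ UniformSpace.ball y (finUnion e t) := interior_subset hyz
  exact ⟨y, hxy, htV hyz'⟩

theorem metrizable_of_mSpace (hX : MSpace X)
    (h : HasCountableLocallyUniformCcsStarStarNetbase X) :
    TopologicalSpace.MetrizableSpace X := by
  have := hX.regular
  have := hX.t0
  obtain ⟨U, hU, hUr, hUs⟩ := hX.covers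
  have hcov : ∀ n (x : X), ∃ S ∈ U n, x ∈ S := fun n x => by
    have : x ∈ ⋃₀ U n := (hU n).2 ▸ mem_univ x
    exact this
  have hnhds : ∀ n (x : X), coverStar {x} (U n) ∈ 𝓝 x := fun n x =>
    let ⟨S, hS, hx⟩ := hcov n x
    mem_of_superset (((hU n).1 S hS).mem_nhds hx) fun _ hz =>
      mem_coverStar_singleton.2 ⟨S, hS, hz, hx⟩
  have hcl : ∀ n x, closure (coverStar {x} (U (n + 1))) ⊆ coverStar {x} (U n) := fun n x z hz => by
    obtain ⟨S, hS, hzS⟩ := hcov (n + 1) z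
    obtain ⟨y, hyS, hy⟩ := mem_closure_iff_nhds.1 hz _ (((hU _).1 S hS).mem_nhds hzS)
    obtain ⟨T, hT, hyT, hxT⟩ := mem_coverStar_singleton.1 hy
    obtain ⟨P, hP, hSP⟩ := hUr n S hS
    exact mem_coverStar_singleton.2 ⟨P, hP,
      hSP (mem_coverStar.2 ⟨S, hS, hzS, z, hzS, hzS⟩),
      hSP (mem_coverStar.2 ⟨T, hT, hxT, y, hyT, hyS⟩)⟩
  have hanti : ∀ x, Antitone fun n => coverStar {x} (U n) := fun x =>
    antitone_nat_of_succ_le fun n => subset_closure.trans (hcl n x)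
  have hcluster : ∀ x (s : ℕ → X), (∀ n, s n ∈ coverStar {x} (U n)) →
      ∀ y, MapClusterPt y atTop s → y ∈ ⋂ n, coverStar {x} (U n) := fun x s hs y hy =>
    mem_iInter.2 fun n => hcl n x <| mem_closure_iff_clusterPt.2 <|
      hy.clusterPt.mono <| tendsto_principal.2 <|
      (eventually_ge_atTop (n + 1)).mono fun m hm => hanti x hm (hs m)
  refine metrizable_of_starStarNetbase (fun x => ⟨_, fun n => hnhds n x, hUs x⟩) h
    (fun x => ⋂ n, coverStar {x} (U n)) (fun x => ?_) fun G hG => ?_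
  · refine IsCountablyCompact.of_seq_clusterPt fun z hz => ?_
    obtain ⟨φ, hφ, hφu⟩ := extraction_forall_of_eventually
      (P := fun n k => z k ∈ coverStar {x} (U n)) fun n => hz.mono fun k hk => mem_iInter.1 hk n
    obtain ⟨y, hy⟩ := hUs x _ hφu
    exact ⟨y, hcluster x _ hφu y hy, hy.of_comp hφ.tendsto_atTop⟩
  -- A member of `U (n + 1)` around a point of the closure meets some such `S`, hence lies in its
  -- star and in `G`. The shift by one lets star refinement compare with the star of `x` in `U n`.
  · refine ⟨fun n => ⋃₀ {S ∈ U (n + 1) | coverStar S (U (n + 1)) ⊆ G}, fun n =>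
      ⟨isOpen_sUnion fun S hS => (hU _).1 S hS.1, fun z hz => ?_⟩, fun x hx => ?_⟩
    · obtain ⟨T, hT, hzT⟩ := hcov (n + 1) z
      obtain ⟨y, hyT, S, ⟨hS, hSG⟩, hyS⟩ :=
        mem_closure_iff_nhds.1 hz _ (((hU _).1 T hT).mem_nhds hzT)
      exact hSG (mem_coverStar.2 ⟨T, hT, hzT, y, hyT, hyS⟩)
    · obtain ⟨n, hn⟩ : ∃ n, coverStar {x} (U n) ⊆ G := by
        by_contra! hno
        choose s hs hsG using fun n => not_subset.1 (hno n)
        obtain ⟨y, hy⟩ := hUs x s hs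
        obtain ⟨n, hn⟩ := (mapClusterPt_iff_frequently.1 hy G
          (hG.mem_nhds (hx (hcluster x s hs y hy)))).exists
        exact hsG n hn
      obtain ⟨S, hS, hxS⟩ := hcov (n + 1) x
      obtain ⟨P, hP, hSP⟩ := hUr n S hS
      refine ⟨n, S, ⟨hS, hSP.trans fun z hz => hn ?_⟩, hxS⟩
      exact mem_coverStar_singleton.2 ⟨P, hP, hz,
        hSP (mem_coverStar.2 ⟨S, hS, hxS, x, hxS, hxS⟩)⟩

theorem CollectionwiseNormal.normalSpace (hX : CollectionwiseNormal X) : NormalSpace X := by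
  refine ⟨fun s t hs ht hst => ?_⟩
  -- When `s = t`, the family `{s, t}` has one member and cannot yield two neighborhoods.
  rcases eq_or_ne s t with rfl | hne
  · obtain rfl : s = ∅ := disjoint_self.1 hst
    exact ⟨∅, ∅, isOpen_empty, isOpen_empty, Subset.rfl, Subset.rfl, hst⟩
  obtain ⟨U, hU, hUd⟩ := hX {s, t} (by rintro S (rfl | rfl) <;> assumption) fun x => by
    by_cases hx : x ∈ s
    · refine ⟨tᶜ, ht.isOpen_compl.mem_nhds (Set.disjoint_left.1 hst hx), ?_⟩
      rintro ⟨_, rfl | rfl⟩ hi ⟨_, rfl | rfl⟩ hj <;> simp_all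
    · refine ⟨sᶜ, hs.isOpen_compl.mem_nhds hx, ?_⟩
      rintro ⟨_, rfl | rfl⟩ hi ⟨_, rfl | rfl⟩ hj <;> simp_all
  let i : ({s, t} : Set (Set X)) := ⟨s, Or.inl rfl⟩
  let j : ({s, t} : Set (Set X)) := ⟨t, Or.inr rfl⟩
  exact ⟨U i, U j, (hU i).1, (hU j).1, (hU i).2, (hU j).2,
    hUd.disjoint fun h => hne (congrArg Subtype.val h)⟩

theorem metrizable_of_bigSigma (hq : QSpace X) (hn : CollectionwiseNormal X)
    (hX : BigSigmaSpace X) (h : HasCountableLocallyUniformCcsStarStarNetbase X) :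
    TopologicalSpace.MetrizableSpace X := by
  have := hX.t0
  have := hn.normalSpace
  obtain ⟨C, N, hC, hCc, ⟨N, rfl, hd⟩, hN⟩ := hX.network
  have hK : ∀ x, ∃ K ∈ C, x ∈ K := fun x => by
    have : x ∈ ⋃₀ C := hC ▸ mem_univ x
    exact this
  choose K hKC hxK using hK
  refine metrizable_of_starStarNetbase hq h K (fun x => (hCc _ (hKC x)).2) fun G hG => ?_
  -- Local finiteness makes the union of closures closed, so normality interposes `M n` between it
  -- and `G`.
  have hM : ∀ n, ∃ M, IsOpen M ∧ (⋃ S : {S : N n // closure S.1 ⊆ G}, closure S.1.1) ⊆ M ∧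
      closure M ⊆ G := fun n =>
    normal_exists_closure_subset
      (((hd n).locallyFinite.comp_injective Subtype.val_injective).closure.isClosed_iUnion
        fun _ => isClosed_closure) hG (iUnion_subset fun S => S.2)
  choose M hMo hSM hMG using hM
  refine ⟨M, fun n => ⟨hMo n, hMG n⟩, fun x hx => ?_⟩
  obtain ⟨P, hP, hKP, hPG⟩ := normal_exists_closure_subset (hCc _ (hKC x)).1 hG hx
  obtain ⟨S, hS, hKS, hSP⟩ := hN _ (hKC x) P hP hKP
  obtain ⟨n, hn⟩ := mem_iUnion.1 hS
  exact ⟨n, hSM n (mem_iUnion.2 ⟨⟨⟨S, hn⟩, (closure_mono hSP).trans hPG⟩,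
    subset_closure (hKS (hxK x))⟩)⟩

theorem HasCountableLocallyUniformCsStarNetbase.ccsStarStar [T1Space X] [FirstCountableTopology X]
    (h : HasCountableLocallyUniformCsStarNetbase X) :
    HasCountableLocallyUniformCcsStarStarNetbase X :=
  let ⟨E, B, hE, hl, hEB⟩ := h
  ⟨E, B, hE, hl, hEB.isStarStarNetbase⟩

theorem HasCountableLocallyUniformCsStarNetbase.locallyQuasiUniform
    (h : HasCountableLocallyUniformCsStarNetbase X) :
    HasCountableLocallyQuasiUniformCsStarNetbase X :=
  let ⟨E, B, hE, hl, hEB⟩ := h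
  ⟨E, B, hE, hl.isLocallyQuasiUniform hEB.base, hEB⟩

end Netbase

namespace Netbase

open Set Filter Topology

/-! ### Properties of metrizable spaces -/

section Metric

variable {X : Type*} [MetricSpace X]

/-- The entourages `{(x, y) | dist x y < (1 / 2) ^ n}` of a metric space. -/
def metricEntourages (X : Type*) [MetricSpace X] : Set (SetRel X X) :=
  range fun n : ℕ => {p : X × X | dist p.1 p.2 < (1 / 2) ^ n}

theorem exists_half_pow_lt {ε : ℝ} (hε : 0 < ε) : ∃ n : ℕ, (1 / 2 : ℝ) ^ n < ε :=
  exists_pow_lt_of_lt_one hε (by norm_num)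

theorem isEntourageBase_metricEntourages : IsEntourageBase (metricEntourages X) where
  entourage := by
    rintro _ ⟨n, rfl⟩ x
    show dist x x < _
    rw [dist_self]
    positivity
  directed := by
    rintro _ ⟨m, rfl⟩ _ ⟨n, rfl⟩
    have hle : ∀ {i j : ℕ}, i ≤ j → (1 / 2 : ℝ) ^ j ≤ (1 / 2) ^ i := fun hij =>
      pow_le_pow_of_le_one (by norm_num) (by norm_num) hij
    refine ⟨_, ⟨max m n, rfl⟩, fun p (hp : dist p.1 p.2 < _) => ?_⟩
    exact ⟨hp.trans_le (hle (le_max_left m n)), hp.trans_le (hle (le_max_right m n))⟩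
  nhds_basis x := by
    refine Metric.nhds_basis_ball.to_hasBasis (fun ε hε => ?_) ?_
    · obtain ⟨n, hn⟩ := exists_half_pow_lt hε
      exact ⟨_, ⟨n, rfl⟩, fun y hy => Metric.mem_ball'.2 (lt_trans hy hn)⟩
    · rintro _ ⟨n, rfl⟩
      exact ⟨(1 / 2) ^ n, by positivity, fun y hy => Metric.mem_ball'.1 hy⟩

theorem isLocallyUniform_metricEntourages : IsLocallyUniform (metricEntourages X) := by
  intro x O hO
  obtain ⟨ε, hε, hεO⟩ := Metric.mem_nhds_iff.1 hO
  obtain ⟨n, hn⟩ := exists_half_pow_lt (show 0 < ε / 3 by positivity)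
  refine ⟨_, ⟨n, rfl⟩, ?_⟩
  rintro z ⟨w, ⟨y, hxy, hwy⟩, hwz⟩
  have h1 : dist x y < (1 / 2) ^ n := hxy
  have h2 : dist w y < (1 / 2) ^ n := hwy
  have h3 : dist w z < (1 / 2) ^ n := hwz
  refine hεO (Metric.mem_ball'.2 ?_)
  have := dist_triangle4 x y w z
  rw [dist_comm y w] at this
  linarith

theorem isStarNetbase_metricEntourages (C : Set (Set X)) :
    IsStarNetbase C (metricEntourages X) (metricEntourages X) where
  entourage := isEntourageBase_metricEntourages.entourage
  base := isEntourageBase_metricEntourages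
  network V hV x O hO A _ hA := by
    obtain ⟨U, hU, hUO⟩ := (isEntourageBase_metricEntourages.nhds_basis x).mem_iff.1 hO
    obtain ⟨W, hW, hWUV⟩ := isEntourageBase_metricEntourages.directed U hU V hV
    exact ⟨_, ⟨W, hW, hWUV.trans inter_subset_right, rfl⟩,
      isEntourageBase_metricEntourages.entourage W hW x,
      Subset.trans (fun y hy => (hWUV hy).1) hUO,
      hA _ ((isEntourageBase_metricEntourages.nhds_basis x).mem_of_mem hW)⟩

theorem isStarStarNetbase_metricEntourages (C : Set (Set X)) :
    IsStarStarNetbase C (metricEntourages X) (metricEntourages X) where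
  entourage := isEntourageBase_metricEntourages.entourage
  base := isEntourageBase_metricEntourages
  network V hV _ _ := fun ⟨x, hA⟩ => ⟨V, hV, Subset.rfl, x,
    hA _ ((isEntourageBase_metricEntourages.nhds_basis x).mem_of_mem hV)⟩

theorem closedBarGδSpace_of_metric : ClosedBarGδSpace X := fun F hF => by
  have hcl : F = ⋂ n : ℕ, Metric.cthickening ((1 / 2) ^ n) F := by
    refine Subset.antisymm (subset_iInter fun n => Metric.self_subset_cthickening F)
      fun x hx => ?_
    rw [← hF.closure_eq, Metric.closure_eq_iInter_cthickening' F (range fun n : ℕ => (1 / 2) ^ n)]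
    · simpa using hx
    · intro ε hε
      obtain ⟨n, hn⟩ := exists_half_pow_lt hε
      exact ⟨_, ⟨n, rfl⟩, by positivity, hn.le⟩
  have h1 : ∀ n : ℕ, closure (Metric.thickening ((1 / 2) ^ n) F) ⊆
      Metric.cthickening ((1 / 2) ^ n) F := fun n => Metric.closure_thickening_subset_cthickening _ F
  have h2 : ∀ n : ℕ, F ⊆ Metric.thickening ((1 / 2) ^ n) F := fun n =>
    Metric.self_subset_thickening (by positivity) F
  refine ⟨fun n => Metric.thickening ((1 / 2) ^ n) F, fun n => Metric.isOpen_thickening,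
    Subset.antisymm (subset_iInter h2) ?_,
    Subset.antisymm (subset_iInter fun n => (h2 n).trans subset_closure) ?_⟩
  · exact (iInter_mono fun n => subset_closure.trans (h1 n)).trans hcl.superset
  · exact (iInter_mono h1).trans hcl.superset

/-- A metrically discrete family is strongly discrete. -/
theorem isStronglyDiscrete_of_le_dist {F : Set (Set X)} {ε : ℝ} (hε : 0 < ε)
    (h : ∀ S ∈ F, ∀ T ∈ F, ∀ x ∈ S, ∀ y ∈ T, dist x y < ε → S = T) : IsStronglyDiscrete F := by
  -- Four legs shorter than `ε / 4` join the two members: `p, y, x, z, q`.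
  refine ⟨fun S => Metric.thickening (ε / 4) S, fun S => ⟨Metric.isOpen_thickening,
    Metric.self_subset_thickening (by positivity) _⟩, fun x =>
    ⟨Metric.ball x (ε / 4), Metric.ball_mem_nhds x (by positivity), ?_⟩⟩
  rintro S ⟨y, hy, hyS⟩ T ⟨z, hz, hzT⟩
  obtain ⟨p, hp, hyp⟩ := Metric.mem_thickening_iff.1 hyS
  obtain ⟨q, hq, hzq⟩ := Metric.mem_thickening_iff.1 hzT
  refine Subtype.ext (h _ S.2 _ T.2 p hp q hq ?_)
  have h1 := Metric.mem_ball.1 hy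
  have h2 := Metric.mem_ball.1 hz
  have h3 := dist_triangle4 p y z q
  have h4 := dist_triangle_right y z x
  rw [dist_comm p y] at h3
  linarith

/-- The members of Stone's refinement of the cover by the balls of radius `(1 / 2) ^ m`. -/
def stoneSet (m n : ℕ) (x : X) : Set X :=
  {y | Metric.ball y ((1 / 2) ^ n) ⊆ Metric.ball x ((1 / 2) ^ m) ∧
    ∀ x', WellOrderingRel x' x → y ∉ Metric.ball x' ((1 / 2) ^ m)}

/-- A point within `(1 / 2) ^ n` of a Stone set lies in its ball, while later Stone sets avoid that
ball. -/
theorem isStronglyDiscrete_range_stoneSet (m n : ℕ) :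
    IsStronglyDiscrete (range (stoneSet (X := X) m n)) := by
  refine isStronglyDiscrete_of_le_dist (ε := (1 / 2) ^ n) (by positivity) ?_
  rintro _ ⟨x, rfl⟩ _ ⟨x', rfl⟩ y hy y' hy' hd
  rcases trichotomous_of WellOrderingRel x x' with h | rfl | h
  · exact absurd (hy.1 (Metric.mem_ball'.2 hd)) (hy'.2 x h)
  · rfl
  · exact absurd (hy'.1 (Metric.mem_ball.2 hd)) (hy.2 x' h)

/-- The network of a metric space formed by all Stone sets. -/
def stoneNetwork (X : Type*) [MetricSpace X] : Set (Set X) :=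
  ⋃ k : ℕ, range (stoneSet (X := X) k.unpair.1 k.unpair.2)

theorem isStronglySigmaDiscrete_stoneNetwork : IsStronglySigmaDiscrete (stoneNetwork X) :=
  ⟨_, rfl, fun _ => isStronglyDiscrete_range_stoneSet _ _⟩

theorem isNetwork_stoneNetwork : IsNetwork (stoneNetwork X) := by
  intro U hU z hz
  obtain ⟨ε, hε, hεU⟩ := Metric.isOpen_iff.1 hU z hz
  obtain ⟨m, hm⟩ := exists_half_pow_lt (half_pos hε)
  have hne : {x : X | z ∈ Metric.ball x ((1 / 2) ^ m)}.Nonempty :=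
    ⟨z, Metric.mem_ball_self (by positivity)⟩
  let x := (WellOrderingRel.isWellOrder (α := X)).wf.min _ hne
  have hx : z ∈ Metric.ball x ((1 / 2) ^ m) := WellFounded.min_mem _ _ hne
  obtain ⟨δ, hδ, hδx⟩ := Metric.isOpen_iff.1 Metric.isOpen_ball z hx
  obtain ⟨n, hn⟩ := exists_half_pow_lt hδ
  refine ⟨stoneSet m n x, mem_iUnion.2 ⟨Nat.pair m n, x, by simp⟩,
    ⟨(Metric.ball_subset_ball hn.le).trans hδx,
      fun x' hx' hz' => WellFounded.notMem_of_lt_min hx' hz'⟩, fun y hy => hεU ?_⟩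
  have h1 : dist y x < (1 / 2) ^ m := hy.1 (Metric.mem_ball_self (by positivity))
  have h2 : dist z x < (1 / 2) ^ m := hx
  have := dist_triangle_right y z x
  exact Metric.mem_ball.2 (by linarith)

theorem IsStronglyDiscrete.isDiscrete {Y : Type*} [TopologicalSpace Y] {F : Set (Set Y)}
    (h : IsStronglyDiscrete F) : IsDiscrete F :=
  let ⟨_, hU, hd⟩ := h
  hd.mono fun S => (hU S).2

theorem strongSigmaSpace_of_metric : StrongSigmaSpace X where
  regular := inferInstance
  t0 := inferInstance
  network := ⟨_, isStronglySigmaDiscrete_stoneNetwork, isNetwork_stoneNetwork⟩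

theorem bigSigmaSpace_of_metric : BigSigmaSpace X where
  regular := inferInstance
  t0 := inferInstance
  network := by
    obtain ⟨G, hG, hd⟩ := isStronglySigmaDiscrete_stoneNetwork (X := X)
    refine ⟨range fun x => {x}, stoneNetwork X,
      eq_univ_of_forall fun x => ⟨{x}, ⟨x, rfl⟩, rfl⟩, ?_,
      ⟨G, hG, fun i => (hd i).isDiscrete⟩, ?_⟩
    · rintro _ ⟨x, rfl⟩
      exact ⟨isClosed_singleton, isCountablyCompact_singleton⟩
    · rintro _ ⟨x, rfl⟩ U hU hxU
      obtain ⟨S, hS, hxS, hSU⟩ := isNetwork_stoneNetwork U hU x (singleton_subset_iff.1 hxU)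
      exact ⟨S, hS, singleton_subset_iff.2 hxS, hSU⟩

theorem collectionwiseNormal_of_metric : CollectionwiseNormal X := by
  intro F hF hd
  have hr : ∀ x : X, ∃ r > 0, {S : F | (Metric.ball x r ∩ S).Nonempty}.Subsingleton := fun x =>
    let ⟨O, hO, hs⟩ := hd x
    let ⟨r, hr, hrO⟩ := Metric.mem_nhds_iff.1 hO
    ⟨r, hr, hs.anti fun S hS => hS.mono (inter_subset_inter_left _ hrO)⟩
  choose r hr0 hr using hr
  have hle : ∀ S T : F, S ≠ T → ∀ x ∈ S.1, ∀ y ∈ T.1, r x ≤ dist x y := by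
    intro S T hST x hx y hy
    by_contra! hlt
    exact hST (hr x ⟨x, Metric.mem_ball_self (hr0 x), hx⟩ ⟨y, Metric.mem_ball'.2 hlt, hy⟩)
  obtain ⟨V, hV, hVd⟩ := exists_discrete_expansion (F := fun S : F => S.1)
    -- By `hle`, `dist x y` bounds both radii, so the balls of half radius are disjoint.
    (U := fun S : F => ⋃ x ∈ S.1, Metric.ball x (r x / 2)) (fun S => hF S S.2) hd
    (fun S => isOpen_biUnion fun _ _ => Metric.isOpen_ball)
    (fun S x hx => mem_biUnion hx (Metric.mem_ball_self (half_pos (hr0 x)))) fun S T hST => by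
      refine disjoint_iUnion₂_left.2 fun x hx => disjoint_iUnion₂_right.2 fun y hy => ?_
      refine Metric.ball_disjoint_ball ?_
      have h1 := hle S T hST x hx y hy
      have h2 := hle T S hST.symm y hy x hx
      rw [dist_comm] at h2
      linarith
  exact ⟨V, fun S => ⟨(hV S).1, (hV S).2.1⟩, hVd⟩

theorem mSpace_of_metric : MSpace X where
  regular := inferInstance
  t0 := inferInstance
  covers := by
    -- Ratio `1 / 3`: a point of the star of a ball is three radii at most from its center, by way
    -- of `y` and `p`.
    refine ⟨fun n => range fun x => Metric.ball x ((1 / 3) ^ n), fun n => ⟨?_, ?_⟩,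
      fun n => ?_, fun x s hs => ⟨x, ?_⟩⟩
    · rintro _ ⟨x, rfl⟩
      exact Metric.isOpen_ball
    · exact eq_univ_of_forall fun x => ⟨_, ⟨x, rfl⟩, Metric.mem_ball_self (by positivity)⟩
    · rintro _ ⟨x, rfl⟩
      refine ⟨_, ⟨x, rfl⟩, fun z hz => ?_⟩
      obtain ⟨_, ⟨y, rfl⟩, hzy, p, hpy, hpx⟩ := mem_coverStar.1 hz
      have h1 := Metric.mem_ball.1 hzy
      have h2 := Metric.mem_ball'.1 hpy
      have h3 := Metric.mem_ball.1 hpx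
      have h4 := dist_triangle4 z y p x
      rw [pow_succ] at h1 h2 h3
      exact Metric.mem_ball.2 (by linarith)
    · refine Tendsto.mapClusterPt (tendsto_iff_dist_tendsto_zero.2 ?_)
      have hlim : Tendsto (fun n : ℕ => (1 / 3 : ℝ) ^ n + (1 / 3) ^ n) atTop (𝓝 0) := by
        have := tendsto_pow_atTop_nhds_zero_of_lt_one (r := (1 / 3 : ℝ)) (by norm_num) (by norm_num)
        simpa using this.add this
      refine squeeze_zero (fun _ => dist_nonneg) (fun n => ?_) hlim
      obtain ⟨_, ⟨y, rfl⟩, hsy, hxy⟩ := mem_coverStar_singleton.1 (hs n)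
      have h1 := Metric.mem_ball.1 hsy
      have h2 := Metric.mem_ball.1 hxy
      have h3 := dist_triangle_right (s n) x y
      linarith

end Metric

end Netbase

/-! ### The equivalence of the six conditions -/

theorem theoremt (X : Type*) [TopologicalSpace X] [T0Space X] :
    List.TFAE [
      TopologicalSpace.MetrizableSpace X,
      FirstCountableTopology X ∧ Netbase.ClosedBarGδSpace X ∧
        Netbase.HasCountableLocallyUniformCsStarNetbase X,
      FirstCountableTopology X ∧ Netbase.StrongSigmaSpace X ∧
        Netbase.HasCountableLocallyQuasiUniformCsStarNetbase X,
      FirstCountableTopology X ∧ Netbase.CollectionwiseNormal X ∧ Netbase.BigSigmaSpace X ∧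
        Netbase.HasCountableLocallyUniformCsStarNetbase X,
      Netbase.MSpace X ∧ Netbase.HasCountableLocallyUniformCcsStarStarNetbase X,
      Netbase.QSpace X ∧ Netbase.CollectionwiseNormal X ∧ Netbase.BigSigmaSpace X ∧
        Netbase.HasCountableLocallyUniformCcsStarStarNetbase X] := by
  have hcs : TopologicalSpace.MetrizableSpace X →
      FirstCountableTopology X ∧ Netbase.HasCountableLocallyUniformCsStarNetbase X := fun _ => by
    let _ := TopologicalSpace.metrizableSpaceMetric X
    exact ⟨inferInstance, _, _, Set.countable_range _, Netbase.isLocallyUniform_metricEntourages,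
      Netbase.isStarNetbase_metricEntourages _⟩
  tfae_have 1 → 2 := fun h => by
    refine ⟨(hcs h).1, ?_, (hcs h).2⟩
    let _ := TopologicalSpace.metrizableSpaceMetric X
    exact Netbase.closedBarGδSpace_of_metric
  tfae_have 1 → 3 := fun h => by
    refine ⟨(hcs h).1, ?_, (hcs h).2.locallyQuasiUniform⟩
    let _ := TopologicalSpace.metrizableSpaceMetric X
    exact Netbase.strongSigmaSpace_of_metric
  tfae_have 1 → 4 := fun h => by
    refine ⟨(hcs h).1, ?_, ?_, (hcs h).2⟩
    all_goals let _ := TopologicalSpace.metrizableSpaceMetric X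
    exacts [Netbase.collectionwiseNormal_of_metric, Netbase.bigSigmaSpace_of_metric]
  tfae_have 1 → 5 := fun h => by
    let _ := TopologicalSpace.metrizableSpaceMetric X
    exact ⟨Netbase.mSpace_of_metric, _, _, Set.countable_range _,
      Netbase.isLocallyUniform_metricEntourages, Netbase.isStarStarNetbase_metricEntourages _⟩
  tfae_have 4 → 6 := fun ⟨_, hn, hX, h⟩ => by
    -- Regularity together with `T₀` gives the `T₁` axiom needed to pass from `cs*` to `ccs**`.
    have := hX.regular
    exact ⟨Netbase.qSpace_of_firstCountable, hn, hX, h.ccsStarStar⟩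
  tfae_have 2 → 1 := fun ⟨_, hX, h⟩ => Netbase.metrizable_of_closedBarGδ hX h
  tfae_have 3 → 1 := fun ⟨_, hX, h⟩ => Netbase.metrizable_of_strongSigma hX h
  tfae_have 5 → 1 := fun ⟨hX, h⟩ => Netbase.metrizable_of_mSpace hX h
  tfae_have 6 → 1 := fun ⟨hq, hn, hX, h⟩ => Netbase.metrizable_of_bigSigma hq hn hX h
  tfae_finish
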